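/- **Setting.** Let $\mathbf{C}$ be a category and write $c\le d$ if there is a morphism $c\to d$, and $G_c=\operatorname{Aut}(c)$. A *weak push-out* of a span $c_1\leftarrow p\to c_2$ is a pullback square with corners $p,c_1,c_2,d$ that is initial among all pullback squares completing the span: for any pullback square $p,c_1,c_2,z$ on the same span there is a unique morphism $d\to z$ compatible with the maps from $c_1$ and $c_2$. Assume that $\mathbf{C}$ is *of $\mathrm{FI}$ type*: (1) all hom-sets are finite; (2) every morphism is a monomorphism and every endomorphism is an isomorphism; (3) $G_d$ acts transitively on $\operatorname{Hom}(c,d)$ for all $c,d$; (4) for every $d$ there are only finitely many isomorphism classes of objects $c\le d$; (5) $\mathbf{C}$ has pullbacks, and every span in $\mathbf{C}$ has a weak push-out. A *$\mathbf{C}$-module* is a functor $M_\bullet$ from $\mathbf{C}$ to complex vector spaces; it is *finitely generated* if some finite set of its elements is contained in no proper submodule. For a representation $V$ of $G_c$ put $\operatorname{Ind}_c(V)_d=\mathbb{C}[\operatorname{Hom}(c,d)]\otimes_{\mathbb{C}[G_c]}V$. A $\mathbf{C}$-module is *free* if it is isomorphic to a finite direct sum $\bigoplus_i\operatorname{Ind}_{c_i}(V_i)$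 with $V_i$ finite-dimensional, and, with respect to such a presentation, its *dual* is $F^*=\bigoplus_i\operatorname{Ind}_{c_i}(V_i^*)$. The dual is paired with $F$ by $\langle f\otimes\varphi,\,g\otimes x\rangle=\sum_{\psi\in G_c,\ f\circ\psi=g}\varphi(\psi x)$ on each summand $\operatorname{Ind}_c(V^*)_d\times\operatorname{Ind}_c(V)_d$, distinct summands being orthogonal. Tensor products are taken over $\mathbb{C}$, objectwise. By (3), every morphism $f:c\to d$ induces a map on coinvariants $M_c/G_c\to M_d/G_d$. Say that *the coinvariants of $M$ stabilize* if there is a set $X$ of objects that is upward closed ($c\in X$ and $c\le d$ imply $d\in X$) and cofinal (for every object $e$ there is $c\in X$ with $e\le c$) such that for all $c\in X$ and all morphisms $c\to d$ the induced map $M_c/G_c\to M_d/G_d$ is an isomorphism. **Theorem.** Let $M$ be a finitely generated $\mathbf{C}$-module over $\mathbb{C}$, where $\mathbf{C}$ is of $\mathrm{FI}$ type. 1. The coinvariants of $M$ stabilize. 2. For every free $\mathbf{C}$-module $F$, the coinvariants of $F\otimes M$ stabilize. 3. For every free $\mathbf{C}$-module $F$ (with a chosen presentation as a finite direct sum of induction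 modules), the spaces $\operatorname{Hom}_{G_c}(F_c,M_c)$ stabilize: for every object $c$ the canonical map $$\alpha_c:(F^*_c\otimes M_c)/G_c\to\operatorname{Hom}_{G_c}(F_c,M_c),\qquad [\varphi\otimes m]\mapsto\frac1{|G_c|}\sum_{g\in G_c} g\circ\bigl(x\mapsto\langle\varphi,x\rangle m\bigr)\circ g^{-1},$$ is an isomorphism, and there is an upward closed and cofinal set $X$ of objects such that for all $c\in X$ and all morphisms $f:c\to d$ the map $\operatorname{Hom}_{G_c}(F_c,M_c)\to\operatorname{Hom}_{G_d}(F_d,M_d)$ that corresponds under $\alpha_c,\alpha_d$ to the map on coinvariants of $F^*\otimes M$ induced by $f$ is an isomorphism. -/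

import Mathlib

open CategoryTheory CategoryTheory.Limits
open scoped TensorProduct

universe u v w w₁ w₂

/-- A weak push-out square: a pullback square which is initial among the pullback squares
completing the span `f₁, f₂`. -/
def IsWeakPushout {C : Type u} [Category.{v} C] {p c₁ c₂ d : C}
    (f₁ : p ⟶ c₁) (f₂ : p ⟶ c₂) (g₁ : c₁ ⟶ d) (g₂ : c₂ ⟶ d) : Prop :=
  IsPullback f₁ f₂ g₁ g₂ ∧
    ∀ (z : C) (h₁ : c₁ ⟶ z) (h₂ : c₂ ⟶ z), IsPullback f₁ f₂ h₁ h₂ →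
      ∃! h : d ⟶ z, g₁ ≫ h = h₁ ∧ g₂ ≫ h = h₂

/-- Categories of `FI` type. -/
class IsFIType (C : Type u) [Category.{v} C] : Prop where
  finite_hom : ∀ c d : C, Finite (c ⟶ d)
  mono : ∀ {c d : C} (f : c ⟶ d), Mono f
  endo_isIso : ∀ {c : C} (f : c ⟶ c), IsIso f
  transitive : ∀ {c d : C} (f g : c ⟶ d), ∃ σ : Aut d, f ≫ σ.hom = g
  /-- Up to isomorphism, only finitely many objects map to `d`. -/
  finite_below : ∀ d : C, ∃ S : Finset C, ∀ c : C, Nonempty (c ⟶ d) → ∃ s ∈ S, Nonempty (c ≅ s)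
  hasPullbacks : HasPullbacks C
  weakPushout : ∀ {p c₁ c₂ : C} (f₁ : p ⟶ c₁) (f₂ : p ⟶ c₂),
    ∃ (d : C) (g₁ : c₁ ⟶ d) (g₂ : c₂ ⟶ d), IsWeakPushout f₁ f₂ g₁ g₂

/-- The automorphism groups of a category of `FI` type are finite. -/
noncomputable instance autFintype {C : Type u} [Category.{v} C] [IsFIType C] (c : C) :
    Fintype (Aut c) :=
  haveI := IsFIType.finite_hom c c
  haveI : Finite (Aut c) := Finite.of_injective (fun g : Aut c => g.hom) fun _ _ h => Iso.ext h
  Fintype.ofFinite _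

section CModules

variable {C : Type u} [Category.{v} C]

/-- The representation of `G_c = Aut c` on the value `M_c` of a `C`-module `M`. -/
def autRep (M : C ⥤ ModuleCat.{w} ℂ) (c : C) : Representation ℂ (Aut c) (M.obj c) where
  toFun g := (M.map g.hom).hom
  map_one' := by
    change (M.map (𝟙 c)).hom = _
    rw [M.map_id]; rfl
  map_mul' g h := by
    change (M.map (h.hom ≫ g.hom)).hom = _
    rw [M.map_comp]; rfl

/-- A `C`-module is finitely generated if some finite set of its elements is contained in no
proper `C`-submodule. -/
def IsFinitelyGenerated (M : C ⥤ ModuleCat.{w} ℂ) : Prop :=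
  ∃ S : Finset (Σ c : C, M.obj c), ∀ N : ∀ c : C, Submodule ℂ (M.obj c),
    (∀ (c d : C) (f : c ⟶ d), ∀ x ∈ N c, (M.map f).hom x ∈ N d) →
    (∀ s ∈ S, s.2 ∈ N s.1) → ∀ c : C, N c = ⊤

/-- The pointwise tensor product over `ℂ` of two `C`-modules. -/
def tensorModule (M : C ⥤ ModuleCat.{w₁} ℂ) (N : C ⥤ ModuleCat.{w₂} ℂ) :
    C ⥤ ModuleCat.{max w₁ w₂} ℂ where
  obj c := ModuleCat.of ℂ (M.obj c ⊗[ℂ] N.obj c)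
  map f := ModuleCat.ofHom (TensorProduct.map (M.map f).hom (N.map f).hom)
  map_id c := by
    ext : 1
    simp
  map_comp f g := by
    ext : 1
    simp [TensorProduct.map_comp]

/-- The coinvariant quotient `M_c / G_c`. -/
abbrev Coinv (M : C ⥤ ModuleCat.{w} ℂ) (c : C) : Type w :=
  (autRep M c).Coinvariants

/-- The map `M_c / G_c → M_d / G_d` induced by a morphism `f : c ⟶ d`. -/
noncomputable def coinvMap [IsFIType C] (M : C ⥤ ModuleCat.{w} ℂ) {c d : C} (f : c ⟶ d) :
    Coinv M c →ₗ[ℂ] Coinv M d :=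
  Representation.Coinvariants.lift (autRep M c)
    (Representation.Coinvariants.mk (autRep M d) ∘ₗ (M.map f).hom) (by
      intro g
      obtain ⟨σ, hσ⟩ := IsFIType.transitive f (g.hom ≫ f)
      ext x
      have h : (M.map f).hom (autRep M c g x) = autRep M d σ ((M.map f).hom x) := by
        change (M.map f).hom ((M.map g.hom).hom x) = (M.map σ.hom).hom ((M.map f).hom x)
        rw [← LinearMap.comp_apply, ← LinearMap.comp_apply, ← ModuleCat.hom_comp,
          ← ModuleCat.hom_comp, ← M.map_comp, ← M.map_comp, hσ]
      simp [h])

/-- A set of objects is upward closed for the preorder `c ≤ d ↔ Nonempty (c ⟶ d)`. -/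
def IsUpwardClosed (X : Set C) : Prop :=
  ∀ c d : C, c ∈ X → Nonempty (c ⟶ d) → d ∈ X

/-- A set of objects is cofinal for the preorder `c ≤ d ↔ Nonempty (c ⟶ d)`. -/
def IsCofinalSet (X : Set C) : Prop :=
  ∀ e : C, ∃ c ∈ X, Nonempty (e ⟶ c)

/-- The coinvariants of `M` stabilize: on an upward closed and cofinal set of objects,
all induced maps between coinvariants are isomorphisms. -/
def CoinvariantsStabilize [IsFIType C] (M : C ⥤ ModuleCat.{w} ℂ) : Prop :=
  ∃ X : Set C, IsUpwardClosed X ∧ IsCofinalSet X ∧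
    ∀ c ∈ X, ∀ (d : C) (f : c ⟶ d), Function.Bijective (coinvMap M f)

/-- The relations `(f ∘ g) ⊗ x = f ⊗ g x`, for `g ∈ G_c`, which cut out
`ℂ[Hom(c, d)] ⊗_{G_c} V` as a quotient of `ℂ[Hom(c, d)] ⊗ V = (Hom(c, d) →₀ V)`. -/
noncomputable def indRel {c : C} {V : Type w} [AddCommGroup V] [Module ℂ V]
    (ρ : Representation ℂ (Aut c) V) (d : C) : Submodule ℂ ((c ⟶ d) →₀ V) :=
  Submodule.span ℂ (Set.range fun t : Aut c × (c ⟶ d) × V =>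
    Finsupp.single (t.1.hom ≫ t.2.1) t.2.2 - Finsupp.single t.2.1 (ρ t.1 t.2.2))

/-- `Ind_c(V)_d = ℂ[Hom(c, d)] ⊗_{G_c} V`. -/
abbrev IndObj {c : C} {V : Type w} [AddCommGroup V] [Module ℂ V]
    (ρ : Representation ℂ (Aut c) V) (d : C) : Type (max v w) :=
  ((c ⟶ d) →₀ V) ⧸ indRel ρ d

theorem indRel_le_comap {c : C} {V : Type w} [AddCommGroup V] [Module ℂ V]
    (ρ : Representation ℂ (Aut c) V) {d e : C} (h : d ⟶ e) :
    indRel ρ d ≤ (indRel ρ e).comap (Finsupp.lmapDomain V ℂ fun f : c ⟶ d => f ≫ h) := by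
  refine Submodule.span_le.2 ?_
  rintro _ ⟨⟨g, f, x⟩, rfl⟩
  refine Submodule.subset_span ⟨(g, f ≫ h, x), ?_⟩
  simp [Finsupp.mapDomain_sub, Finsupp.mapDomain_single]

/-- Postcomposition with `h : d ⟶ e` as a map `Ind_c(V)_d → Ind_c(V)_e`. -/
noncomputable def indMap {c : C} {V : Type w} [AddCommGroup V] [Module ℂ V]
    (ρ : Representation ℂ (Aut c) V) {d e : C} (h : d ⟶ e) : IndObj ρ d →ₗ[ℂ] IndObj ρ e :=
  Submodule.mapQ (indRel ρ d) (indRel ρ e) (Finsupp.lmapDomain V ℂ fun f : c ⟶ d => f ≫ h)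
    (indRel_le_comap ρ h)

theorem indMap_mk {c : C} {V : Type w} [AddCommGroup V] [Module ℂ V]
    (ρ : Representation ℂ (Aut c) V) {d e : C} (h : d ⟶ e) (y : (c ⟶ d) →₀ V) :
    indMap ρ h (Submodule.Quotient.mk y) =
      Submodule.Quotient.mk (Finsupp.mapDomain (fun f : c ⟶ d => f ≫ h) y) := rfl

theorem indMap_id {c : C} {V : Type w} [AddCommGroup V] [Module ℂ V]
    (ρ : Representation ℂ (Aut c) V) (d : C) (x : IndObj ρ d) : indMap ρ (𝟙 d) x = x := by
  obtain ⟨y, rfl⟩ := Submodule.Quotient.mk_surjective _ x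
  rw [indMap_mk]
  simp only [Category.comp_id]
  exact congrArg _ Finsupp.mapDomain_id

theorem indMap_comp {c : C} {V : Type w} [AddCommGroup V] [Module ℂ V]
    (ρ : Representation ℂ (Aut c) V) {d e z : C} (h : d ⟶ e) (k : e ⟶ z) (x : IndObj ρ d) :
    indMap ρ (h ≫ k) x = indMap ρ k (indMap ρ h x) := by
  obtain ⟨y, rfl⟩ := Submodule.Quotient.mk_surjective _ x
  rw [indMap_mk, indMap_mk, indMap_mk, ← Finsupp.mapDomain_comp]
  simp [Function.comp_def]

end CModules

/-- The data presenting a free `C`-module as a finite direct sum `⊕ᵢ Ind_{cᵢ}(Vᵢ)`, with each `Vᵢ`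
a finite-dimensional representation of `G_{cᵢ}`. -/
structure FreeData (C : Type u) [Category.{v} C] where
  n : ℕ
  base : Fin n → C
  V : Fin n → Type w
  [addCommGroup : ∀ i, AddCommGroup (V i)]
  [module : ∀ i, Module ℂ (V i)]
  [finiteDimensional : ∀ i, FiniteDimensional ℂ (V i)]
  rep : ∀ i, Representation ℂ (Aut (base i)) (V i)

attribute [instance] FreeData.addCommGroup FreeData.module FreeData.finiteDimensional

section Free

variable {C : Type u} [Category.{v} C]

/-- The direct sum `⊕ᵢ Ind_{cᵢ}(Vᵢ)` (over a finite index set, hence a product). -/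
noncomputable def FreeData.toModule (P : FreeData.{u, v, w} C) :
    C ⥤ ModuleCat.{max v w} ℂ where
  obj d := ModuleCat.of ℂ (∀ i, IndObj (P.rep i) d)
  map h := ModuleCat.ofHom (LinearMap.pi fun i => indMap (P.rep i) h ∘ₗ LinearMap.proj i)
  map_id d := ModuleCat.hom_ext (LinearMap.ext fun x => funext fun i =>
    indMap_id (P.rep i) d (x i))
  map_comp h k := ModuleCat.hom_ext (LinearMap.ext fun x => funext fun i =>
    indMap_comp (P.rep i) h k (x i))

/-- A `C`-module is free if it is isomorphic to a finite direct sum of induction modules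
`Ind_c(V)` of finite-dimensional representations. -/
def IsFreeModule (F : C ⥤ ModuleCat.{max v w} ℂ) : Prop :=
  ∃ P : FreeData.{u, v, w} C, Nonempty (F ≅ P.toModule)

/-- The data of the dual free module `⊕ᵢ Ind_{cᵢ}(Vᵢ*)`. -/
def FreeData.dual (P : FreeData.{u, v, w} C) : FreeData.{u, v, w} C where
  n := P.n
  base := P.base
  V i := Module.Dual ℂ (P.V i)
  rep i := (P.rep i).dual

open Classical in
/-- The bilinear form `⟨f ⊗ φ, g ⊗ x⟩ = ∑_{ψ ∈ G_c, f ∘ ψ = g} φ (ψ x)`, before passing to the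
quotients over `G_c`. -/
noncomputable def rawPairing [IsFIType C] {c : C} {V : Type w} [AddCommGroup V] [Module ℂ V]
    (ρ : Representation ℂ (Aut c) V) (d : C) :
    ((c ⟶ d) →₀ Module.Dual ℂ V) →ₗ[ℂ] ((c ⟶ d) →₀ V) →ₗ[ℂ] ℂ :=
  Finsupp.lsum ℂ fun f => LinearMap.flip (Finsupp.lsum ℂ fun g =>
    ∑ ψ : Aut c, if ψ.hom ≫ f = g then Module.Dual.eval ℂ V ∘ₗ ρ ψ else 0)

open Classical in
theorem rawPairing_single [IsFIType C] {c : C} {V : Type w} [AddCommGroup V] [Module ℂ V]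
    (ρ : Representation ℂ (Aut c) V) (d : C) (f g : c ⟶ d) (φ : Module.Dual ℂ V) (x : V) :
    rawPairing ρ d (Finsupp.single f φ) (Finsupp.single g x) =
      ∑ ψ : Aut c, if ψ.hom ≫ f = g then φ (ρ ψ x) else 0 := by
  simp only [rawPairing, Finsupp.lsum_single, LinearMap.flip_apply, LinearMap.sum_apply]
  refine Finset.sum_congr rfl fun ψ _ => ?_
  split_ifs <;> simp

theorem rawPairing_right [IsFIType C] {c : C} {V : Type w} [AddCommGroup V] [Module ℂ V]
    (ρ : Representation ℂ (Aut c) V) (d : C) (a : (c ⟶ d) →₀ Module.Dual ℂ V) :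
    indRel ρ d ≤ LinearMap.ker (rawPairing ρ d a) := by
  classical
  refine Submodule.span_le.2 ?_
  rintro _ ⟨⟨τ, g, x⟩, rfl⟩
  simp only [SetLike.mem_coe, LinearMap.mem_ker, map_sub, sub_eq_zero]
  induction a using Finsupp.induction_linear with
  | zero => simp
  | add a b ha hb => simp [ha, hb]
  | single f φ =>
    rw [rawPairing_single, rawPairing_single]
    refine (Fintype.sum_equiv (Equiv.mulRight τ) _ _ fun ψ => ?_).symm
    have h : ((ψ * τ : Aut c).hom ≫ f = τ.hom ≫ g) ↔ ψ.hom ≫ f = g := by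
      rw [show (ψ * τ : Aut c).hom = τ.hom ≫ ψ.hom from rfl, Category.assoc]
      exact Iso.cancel_iso_hom_left (show c ≅ c from τ) _ _
    simp [h]

theorem rawPairing_left [IsFIType C] {c : C} {V : Type w} [AddCommGroup V] [Module ℂ V]
    (ρ : Representation ℂ (Aut c) V) (d : C) :
    indRel ρ.dual d ≤ LinearMap.ker (rawPairing ρ d) := by
  classical
  refine Submodule.span_le.2 ?_
  rintro _ ⟨⟨τ, f, φ⟩, rfl⟩
  simp only [SetLike.mem_coe, LinearMap.mem_ker, map_sub, sub_eq_zero]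
  ext g x
  simp only [LinearMap.comp_apply, Finsupp.lsingle_apply]
  rw [rawPairing_single, rawPairing_single]
  refine Fintype.sum_equiv (Equiv.mulLeft τ) _ _ fun ψ => ?_
  simp [show (τ * ψ : Aut c).hom = ψ.hom ≫ τ.hom from rfl, Module.Dual.transpose_apply]

/-- The pairing `Ind_c(V*)_d × Ind_c(V)_d → ℂ`,
`⟨f ⊗ φ, g ⊗ x⟩ = ∑_{ψ ∈ G_c, f ∘ ψ = g} φ (ψ x)`. -/
noncomputable def indPairing [IsFIType C] {c : C} {V : Type w} [AddCommGroup V] [Module ℂ V]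
    (ρ : Representation ℂ (Aut c) V) (d : C) :
    IndObj ρ.dual d →ₗ[ℂ] IndObj ρ d →ₗ[ℂ] ℂ :=
  LinearMap.flip (Submodule.liftQ (indRel ρ d)
    (LinearMap.flip (Submodule.liftQ (indRel ρ.dual d) (rawPairing ρ d) (rawPairing_left ρ d)))
    (by
      intro y hy
      rw [LinearMap.mem_ker]
      ext a
      exact rawPairing_right ρ d _ hy))

theorem indPairing_map [IsFIType C] {c : C} {V : Type w} [AddCommGroup V] [Module ℂ V]
    (ρ : Representation ℂ (Aut c) V) {d e : C} (h : d ⟶ e) (a : IndObj ρ.dual d)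
    (x : IndObj ρ d) : indPairing ρ e (indMap ρ.dual h a) (indMap ρ h x) = indPairing ρ d a x := by
  classical
  obtain ⟨a, rfl⟩ := Submodule.Quotient.mk_surjective _ a
  obtain ⟨x, rfl⟩ := Submodule.Quotient.mk_surjective _ x
  change rawPairing ρ e (Finsupp.mapDomain _ a) (Finsupp.mapDomain _ x) = rawPairing ρ d a x
  induction a using Finsupp.induction_linear with
  | zero => simp
  | add a b ha hb => simp [Finsupp.mapDomain_add, ha, hb]
  | single f φ =>
    induction x using Finsupp.induction_linear with
    | zero => simp
    | add a b ha hb => simp only [Finsupp.mapDomain_add, map_add, ha, hb]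
    | single g x =>
      have := IsFIType.mono h
      rw [Finsupp.mapDomain_single, Finsupp.mapDomain_single, rawPairing_single, rawPairing_single]
      refine Finset.sum_congr rfl fun ψ _ => ?_
      rw [← Category.assoc, cancel_mono]

/-- The evaluation pairing `(F*)_d × F_d → ℂ` of a free module with its dual: distinct summands
are orthogonal. -/
noncomputable def FreeData.pairing [IsFIType C] (P : FreeData.{u, v, w} C) (d : C) :
    P.dual.toModule.obj d →ₗ[ℂ] P.toModule.obj d →ₗ[ℂ] ℂ :=
  ∑ i : Fin P.n, (indPairing (P.rep i) d).compl₁₂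
    (LinearMap.proj (R := ℂ) (φ := fun i => IndObj (P.rep i).dual d) i)
    (LinearMap.proj (R := ℂ) (φ := fun i => IndObj (P.rep i) d) i)

theorem FreeData.pairing_map [IsFIType C] (P : FreeData.{u, v, w} C) {d e : C} (h : d ⟶ e)
    (a : P.dual.toModule.obj d) (x : P.toModule.obj d) :
    P.pairing e ((P.dual.toModule.map h).hom a) ((P.toModule.map h).hom x) = P.pairing d a x := by
  simp only [FreeData.pairing, LinearMap.sum_apply]
  exact Finset.sum_congr rfl fun i _ => indPairing_map (P.rep i) h _ _

/-- The contraction `(F*)_d ⊗ M_d → Hom_ℂ(F_d, M_d)`, `φ ⊗ m ↦ (x ↦ ⟨φ, x⟩ m)`, where `F` is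
identified with `⊕ᵢ Ind_{cᵢ}(Vᵢ)` through `e`. -/
noncomputable def contraction [IsFIType C] {F : C ⥤ ModuleCat.{max v w} ℂ}
    (P : FreeData.{u, v, w} C) (e : F ≅ P.toModule) (M : C ⥤ ModuleCat.{w₁} ℂ) (d : C) :
    (tensorModule P.dual.toModule M).obj d →ₗ[ℂ] (F.obj d →ₗ[ℂ] M.obj d) :=
  dualTensorHom ℂ (F.obj d) (M.obj d) ∘ₗ
    LinearMap.rTensor (M.obj d) ((P.pairing d).compl₂ (e.hom.app d).hom)

theorem contraction_autRep [IsFIType C] {F : C ⥤ ModuleCat.{max v w} ℂ}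
    (P : FreeData.{u, v, w} C) (e : F ≅ P.toModule) (M : C ⥤ ModuleCat.{w₁} ℂ) (d : C)
    (g : Aut d) (t : (tensorModule P.dual.toModule M).obj d) :
    contraction P e M d (autRep (tensorModule P.dual.toModule M) d g t) =
      Representation.linHom (autRep F d) (autRep M d) g (contraction P e M d t) := by
  have key : contraction P e M d ∘ₗ autRep (tensorModule P.dual.toModule M) d g =
      Representation.linHom (autRep F d) (autRep M d) g ∘ₗ contraction P e M d := by
    refine TensorProduct.ext' (M := P.dual.toModule.obj d) (N := M.obj d) fun a m => ?_
    ext x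
    have hx : (P.toModule.map g.hom).hom ((e.hom.app d).hom (autRep F d g⁻¹ x)) =
        (e.hom.app d).hom x := by
      have h := congrArg (fun k => k.hom (autRep F d g⁻¹ x)) (e.hom.naturality g.hom)
      simp only [ModuleCat.hom_comp, LinearMap.comp_apply] at h
      rw [← h]
      exact congrArg _ (Representation.self_inv_apply (autRep F d) g x)
    have hp := P.pairing_map g.hom a ((e.hom.app d).hom (autRep F d g⁻¹ x))
    rw [hx] at hp
    change P.pairing d ((P.dual.toModule.map g.hom).hom a) ((e.hom.app d).hom x) •
      (M.map g.hom).hom m = autRep M d g (P.pairing d a ((e.hom.app d).hom (autRep F d g⁻¹ x)) • m)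
    rw [hp, map_smul]
    rfl
  exact LinearMap.congr_fun key t

/-- Averaging over a finite group `G`: the map `T ↦ |G|⁻¹ ∑_{g ∈ G} g ∘ T ∘ g⁻¹` from linear maps to
`G`-equivariant ones. -/
noncomputable def averageHom {G : Type*} [Group G] [Fintype G] {V W : Type*} [AddCommGroup V]
    [Module ℂ V] [AddCommGroup W] [Module ℂ W] (ρ : Representation ℂ G V)
    (σ : Representation ℂ G W) : (V →ₗ[ℂ] W) →ₗ[ℂ] ρ.IntertwiningMap σ :=
  (Representation.invariantsEquivIntertwiningMap ρ σ).toLinearMap ∘ₗ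
    LinearMap.codRestrict (ρ.linHom σ).invariants
      ((Fintype.card G : ℂ)⁻¹ • ∑ g : G, ρ.linHom σ g) (by
        intro T h
        rw [LinearMap.smul_apply, LinearMap.sum_apply, map_smul, map_sum]
        congr 1
        refine Fintype.sum_equiv (Equiv.mulLeft h) _ _ fun g => ?_
        rw [Equiv.coe_mulLeft, map_mul]
        rfl)

theorem averageHom_linHom {G : Type*} [Group G] [Fintype G] {V W : Type*} [AddCommGroup V]
    [Module ℂ V] [AddCommGroup W] [Module ℂ W] (ρ : Representation ℂ G V)
    (σ : Representation ℂ G W) (h : G) (T : V →ₗ[ℂ] W) :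
    averageHom ρ σ (ρ.linHom σ h T) = averageHom ρ σ T := by
  refine congrArg (Representation.invariantsEquivIntertwiningMap ρ σ) (Subtype.ext ?_)
  change ((Fintype.card G : ℂ)⁻¹ • ∑ g : G, ρ.linHom σ g) (ρ.linHom σ h T) =
    ((Fintype.card G : ℂ)⁻¹ • ∑ g : G, ρ.linHom σ g) T
  rw [LinearMap.smul_apply, LinearMap.smul_apply, LinearMap.sum_apply, LinearMap.sum_apply]
  congr 1
  refine Fintype.sum_equiv (Equiv.mulRight h) _ _ fun g => ?_
  rw [Equiv.coe_mulRight, map_mul]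
  rfl

/-- The canonical map `((F*)_d ⊗ M_d) / G_d → Hom_{G_d}(F_d, M_d)`: contract, then average over
`G_d`. -/
noncomputable def coinvToHom [IsFIType C] {F : C ⥤ ModuleCat.{max v w} ℂ}
    (P : FreeData.{u, v, w} C) (e : F ≅ P.toModule) (M : C ⥤ ModuleCat.{w₁} ℂ) (d : C) :
    Coinv (tensorModule P.dual.toModule M) d →ₗ[ℂ]
      (autRep F d).IntertwiningMap (autRep M d) :=
  Representation.Coinvariants.lift (autRep (tensorModule P.dual.toModule M) d)
    (averageHom (autRep F d) (autRep M d) ∘ₗ contraction P e M d)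
    (fun g => LinearMap.ext fun t =>
      (congrArg _ (contraction_autRep P e M d g t)).trans (averageHom_linHom _ _ g _))

end Free

/-! ### Finite generation of free modules and of tensor products. -/

section Generation

variable {C : Type u} [Category.{v} C]

/-! Since `G_d` acts transitively on `Hom(c, d)`, all images in `M_d` of one generator have the same
class in `M_d / G_d` (`mk_map_eq_mk_map`). So a finite generating set `S` gives at most `|S|`
spanning vectors of each space of coinvariants, one for each generator that reaches `d`. Above any
object, the set of generators reached becomes maximal, and from there on the induced maps are
surjective. Among the objects further up, one of minimal dimension has only isomorphisms leaving it.
No Noetherian property is needed.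

The tensor statement reduces to this one, because weak push-outs and the finiteness of objects below
a given one make `F ⊗ M` finitely generated (`IsFinitelyGenerated.tensorModule`).

For `Hom`, the pairing of `F` with `F*` is perfect (`FreeData.pairing_bijective`), so contraction
identifies `F*_d ⊗ M_d` with `Hom(F_d, M_d)` equivariantly. Averaging over a finite group in
characteristic zero then identifies coinvariants with intertwiners (`coinvToHom_bijective`), and
stabilization of `F* ⊗ M` is transported. -/

/-- A finite set of generators spans every value of the module under the images of morphisms. -/
theorem IsFinitelyGenerated.exists_span_eq_top {M : C ⥤ ModuleCat.{w} ℂ}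
    (hM : IsFinitelyGenerated M) :
    ∃ S : Finset (Σ c : C, M.obj c), ∀ d : C,
      Submodule.span ℂ {y : M.obj d | ∃ s ∈ S, ∃ f : s.1 ⟶ d, (M.map f).hom s.2 = y} = ⊤ := by
  obtain ⟨S, hS⟩ := hM
  -- The family left to unification is that of the spans themselves: a submodule containing `S`.
  refine ⟨S, hS _ ?_ ?_⟩
  · intro c d f x hx
    refine Submodule.span_induction (p := fun x _ => (M.map f).hom x ∈ _) ?_ ?_ ?_ ?_ hx
    · rintro _ ⟨s, hs, g, rfl⟩
      refine Submodule.subset_span ⟨s, hs, g ≫ f, ?_⟩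
      simp
    · simp
    · intro x y _ _ hx hy
      rw [map_add]
      exact add_mem hx hy
    · intro a x _ hx
      rw [map_smul]
      exact Submodule.smul_mem _ a hx
  · intro s hs
    exact Submodule.subset_span ⟨s, hs, 𝟙 _, by simp⟩

theorem IsFinitelyGenerated.of_iso {M N : C ⥤ ModuleCat.{w} ℂ} (e : M ≅ N)
    (hN : IsFinitelyGenerated N) : IsFinitelyGenerated M := by
  classical
  obtain ⟨S, hS⟩ := hN
  have hinv (c : C) (x : M.obj c) : (e.inv.app c).hom ((e.hom.app c).hom x) = x := by
    rw [← LinearMap.comp_apply, ← ModuleCat.hom_comp, Iso.hom_inv_id_app]; rfl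
  refine ⟨S.image fun s => ⟨s.1, (e.inv.app s.1).hom s.2⟩, fun K hK hSK c => ?_⟩
  have h := hS (fun c => (K c).comap (e.inv.app c).hom) ?_ ?_ c
  · rw [eq_top_iff]
    intro x _
    have hx : (e.hom.app c).hom x ∈ (K c).comap (e.inv.app c).hom := h ▸ Submodule.mem_top
    rwa [Submodule.mem_comap, hinv] at hx
  · intro c d f x hx
    have h := congrArg (fun k => k.hom x) (e.inv.naturality f)
    simp only [ModuleCat.hom_comp, LinearMap.comp_apply] at h
    rw [Submodule.mem_comap, h]
    exact hK c d f _ hx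
  · intro s hs
    exact hSK _ (Finset.mem_image_of_mem _ hs)

/-- Free modules are finitely generated. -/
theorem FreeData.isFinitelyGenerated_toModule (P : FreeData.{u, v, w} C) :
    IsFinitelyGenerated P.toModule := by
  classical
  let b i := Module.finBasis ℂ (P.V i)
  -- The vectors `𝟙 ⊗ b` with `b` in a basis of `V i` suffice, because `f ⊗ b` is the image of `𝟙 ⊗
  -- b` under `f`.
  let gen : (Σ i : Fin P.n, Fin (Module.finrank ℂ (P.V i))) → Σ c : C, P.toModule.obj c :=
    fun t => ⟨P.base t.1, Pi.single (M := fun i => IndObj (P.rep i) (P.base t.1)) t.1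
      (Submodule.Quotient.mk (Finsupp.single (𝟙 _) (b t.1 t.2)))⟩
  refine ⟨Finset.univ.image gen, fun K hK hSK d => ?_⟩
  have key : ∀ (i : Fin P.n) (f : P.base i ⟶ d) (x : P.V i),
      (Pi.single (M := fun i => IndObj (P.rep i) d) i
        (Submodule.Quotient.mk (Finsupp.single f x)) : P.toModule.obj d) ∈ K d := by
    intro i f x
    let L : P.V i →ₗ[ℂ] P.toModule.obj d :=
      LinearMap.single ℂ (fun i => IndObj (P.rep i) d) i ∘ₗ
        (indRel (P.rep i) d).mkQ ∘ₗ Finsupp.lsingle f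
    suffices h : (⊤ : Submodule ℂ (P.V i)) ≤ (K d).comap L from h (Submodule.mem_top (x := x))
    rw [← (b i).span_eq, Submodule.span_le]
    rintro _ ⟨j, rfl⟩
    have h := hK _ _ f _ (hSK _ (Finset.mem_image_of_mem gen (Finset.mem_univ ⟨i, j⟩)))
    have h' : (P.toModule.map f).hom (gen ⟨i, j⟩).2 = L (b i j) := by
      funext k
      change indMap (P.rep k) f (Pi.single (M := fun k => IndObj (P.rep k) (P.base i)) i
        (Submodule.Quotient.mk (Finsupp.single (𝟙 _) (b i j))) k) =
        Pi.single (M := fun i => IndObj (P.rep i) d) i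
          (Submodule.Quotient.mk (Finsupp.single f (b i j))) k
      rcases eq_or_ne k i with rfl | hk
      · rw [Pi.single_eq_same, Pi.single_eq_same, indMap_mk, Finsupp.mapDomain_single,
          Category.id_comp]
      · rw [Pi.single_eq_of_ne hk, Pi.single_eq_of_ne hk, map_zero]
    change L (b i j) ∈ K d
    rwa [← h']
  rw [eq_top_iff]
  intro x _
  have hx : x = ∑ i, Pi.single (M := fun i => IndObj (P.rep i) d) i (x i) :=
    (Finset.univ_sum_single (M := fun i => IndObj (P.rep i) d) x).symm
  rw [hx]
  refine Submodule.sum_mem _ fun i _ => ?_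
  obtain ⟨y, hy⟩ := Submodule.Quotient.mk_surjective _ (x i)
  rw [← hy]
  clear hx hy
  let L : ((P.base i ⟶ d) →₀ P.V i) →ₗ[ℂ] P.toModule.obj d :=
    LinearMap.single ℂ (fun i => IndObj (P.rep i) d) i ∘ₗ (indRel (P.rep i) d).mkQ
  change L y ∈ K d
  induction y using Finsupp.induction_linear with
  | zero => rw [map_zero]; exact zero_mem _
  | add y z hy hz => rw [map_add]; exact add_mem hy hz
  | single f x => exact key i f x

/-- In a category of `FI` type, tensor products of finitely generated modules are finitely
generated: any pair of morphisms `c₁ ⟶ d ⟵ c₂` factors through one of finitely many weak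
push-outs. -/
theorem IsFinitelyGenerated.tensorModule [IsFIType C] {M : C ⥤ ModuleCat.{w₁} ℂ}
    {N : C ⥤ ModuleCat.{w₂} ℂ} (hM : IsFinitelyGenerated M) (hN : IsFinitelyGenerated N) :
    IsFinitelyGenerated (tensorModule M N) := by
  classical
  obtain ⟨S, hS⟩ := hM.exists_span_eq_top
  obtain ⟨T, hT⟩ := hN.exists_span_eq_top
  choose B hB using IsFIType.finite_below (C := C)
  choose W j₁ j₂ hW using fun (p c₁ c₂ : C) (f₁ : p ⟶ c₁) (f₂ : p ⟶ c₂) =>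
    IsFIType.weakPushout f₁ f₂
  -- An index is a pair of generators with a span between their objects, whose apex is one of the
  -- finitely many representatives below the first object.
  let J := Σ t : (Σ (s : S) (_ : T), B s.1.1), (t.2.2.1 ⟶ t.1.1.1) × (t.2.2.1 ⟶ t.2.1.1.1)
  have : ∀ c d : C, Finite (c ⟶ d) := IsFIType.finite_hom
  have : Finite J := inferInstance
  have := Fintype.ofFinite J
  let gen : J → Σ c : C, (_root_.tensorModule M N).obj c := fun t =>
    ⟨W _ _ _ t.2.1 t.2.2, (M.map (j₁ _ _ _ t.2.1 t.2.2)).hom t.1.1.1.2 ⊗ₜ[ℂ]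
      (N.map (j₂ _ _ _ t.2.1 t.2.2)).hom t.1.2.1.1.2⟩
  refine ⟨Finset.univ.image gen, fun K hK hSK d => ?_⟩
  have key : ∀ s ∈ S, ∀ t ∈ T, ∀ (f : s.1 ⟶ d) (g : t.1 ⟶ d),
      ((M.map f).hom s.2 ⊗ₜ[ℂ] (N.map g).hom t.2 : M.obj d ⊗[ℂ] N.obj d) ∈ K d := by
    intro s hs t ht f g
    have := IsFIType.hasPullbacks (C := C)
    obtain ⟨p, hp, ⟨i⟩⟩ := hB s.1 (pullback f g) ⟨pullback.fst f g⟩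
    -- Replacing the pullback by its representative `p` gives a span indexed by `J`. Its square over
    -- `d` is still a pullback, as initiality of the weak push-out requires.
    have hpb : IsPullback (i.inv ≫ pullback.fst f g) (i.inv ≫ pullback.snd f g) f g :=
      (IsPullback.of_hasPullback f g).of_iso i (Iso.refl _) (Iso.refl _) (Iso.refl _)
        (by simp) (by simp) (by simp) (by simp)
    obtain ⟨h, ⟨h₁, h₂⟩, -⟩ := (hW _ _ _ _ _).2 d f g hpb
    have := hK _ _ h _ (hSK _ (Finset.mem_image_of_mem gen (Finset.mem_univ
      ⟨⟨⟨s, hs⟩, ⟨t, ht⟩, ⟨p, hp⟩⟩, i.inv ≫ pullback.fst f g, i.inv ≫ pullback.snd f g⟩)))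
    have e₁ := congrArg (fun k => (M.map k).hom s.2) h₁
    have e₂ := congrArg (fun k => (N.map k).hom t.2) h₂
    simp only [Functor.map_comp, ModuleCat.hom_comp, LinearMap.comp_apply] at e₁ e₂
    rw [← e₁, ← e₂]
    exact this
  rw [eq_top_iff]
  intro z _
  change M.obj d ⊗[ℂ] N.obj d at z
  induction z using TensorProduct.induction_on with
  | zero => exact zero_mem _
  | add x y hx hy => exact add_mem (hx trivial) (hy trivial)
  | tmul x y =>
    have hx : x ∈ Submodule.span ℂ _ := (hS d).symm ▸ Submodule.mem_top
    have hy : y ∈ Submodule.span ℂ _ := (hT d).symm ▸ Submodule.mem_top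
    -- By bilinearity, a tensor of two elements of the spans lies in the span of the tensors of the
    -- spanning vectors.
    have := Submodule.apply_mem_map₂ (TensorProduct.mk ℂ (M.obj d) (N.obj d)) hx hy
    rw [Submodule.map₂_span_span] at this
    refine Submodule.span_le.2 ?_ this
    rintro _ ⟨_, ⟨s, hs, f, rfl⟩, _, ⟨t, ht, g, rfl⟩, rfl⟩
    exact key s hs t ht f g

end Generation

/-! ### Stabilization of coinvariants. -/

section Stabilization

variable {C : Type u} [Category.{v} C] [IsFIType C] (M : C ⥤ ModuleCat.{w} ℂ)

theorem coinvMap_mk {c d : C} (f : c ⟶ d) (x : M.obj c) :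
    coinvMap M f (Representation.Coinvariants.mk (autRep M c) x) =
      Representation.Coinvariants.mk (autRep M d) ((M.map f).hom x) := rfl

/-- Two parallel morphisms differ by an automorphism of the target, which coinvariants do not see.
This is where transitivity enters the count of spanning vectors. -/
theorem mk_map_eq_mk_map {c d : C} (f g : c ⟶ d) (x : M.obj c) :
    Representation.Coinvariants.mk (autRep M d) ((M.map f).hom x) =
      Representation.Coinvariants.mk (autRep M d) ((M.map g).hom x) := by
  obtain ⟨σ, rfl⟩ := IsFIType.transitive f g
  have h : (M.map (f ≫ σ.hom)).hom x = autRep M d σ ((M.map f).hom x) := by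
    rw [M.map_comp]; rfl
  rw [h, Representation.Coinvariants.mk_self_apply]

theorem coinvMap_comp {c d e : C} (f : c ⟶ d) (g : d ⟶ e) :
    coinvMap M (f ≫ g) = coinvMap M g ∘ₗ coinvMap M f := by
  ext x
  simp [coinvMap_mk]

theorem coinvMap_eq_coinvMap {c d : C} (f g : c ⟶ d) : coinvMap M f = coinvMap M g := by
  ext x
  exact mk_map_eq_mk_map M f g x

/-- If the coinvariants have finite dimension and, above every object, all induced maps are
eventually surjective, then the coinvariants stabilize. -/
theorem CoinvariantsStabilize.of_surjective (hfin : ∀ c, Module.Finite ℂ (Coinv M c))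
    (hsurj : ∀ e : C, ∃ c, Nonempty (e ⟶ c) ∧ ∀ (d d' : C) (_ : c ⟶ d) (f : d ⟶ d'),
      Function.Surjective (coinvMap M f)) : CoinvariantsStabilize M := by
  -- Taking every object with only isomorphisms leaving it makes upward closure a two-out-of-three
  -- argument.
  refine ⟨{c | ∀ (d : C) (f : c ⟶ d), Function.Bijective (coinvMap M f)}, ?_, ?_, fun c hc => hc⟩
  · rintro c d hc ⟨f⟩ e g
    have h := hc e (f ≫ g)
    rw [coinvMap_comp, LinearMap.coe_comp] at h
    exact (Function.Bijective.of_comp_iff _ (hc d f)).1 h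
  · intro e
    obtain ⟨c, ⟨k⟩, hc⟩ := hsurj e
    let R : Set C := {d | Nonempty (c ⟶ d)}
    have hR : R.Nonempty := ⟨c, ⟨𝟙 c⟩⟩
    -- Above `c` surjectivity prevents the dimension from growing, and minimality at `d` prevents it
    -- from dropping.
    let d := Function.argminOn (fun d => Module.finrank ℂ (Coinv M d)) R hR
    obtain ⟨l⟩ : Nonempty (c ⟶ d) := Function.argminOn_mem _ R hR
    refine ⟨d, fun d' f => ?_, ⟨k ≫ l⟩⟩
    have hs := hc d d' l f
    have hle : Module.finrank ℂ (Coinv M d) ≤ Module.finrank ℂ (Coinv M d') :=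
      Function.argminOn_le (fun d => Module.finrank ℂ (Coinv M d)) R ⟨l ≫ f⟩
    have heq := le_antisymm hle (LinearMap.finrank_le_finrank_of_surjective hs)
    exact ⟨(LinearMap.injective_iff_surjective_of_finrank_eq_finrank heq).2 hs, hs⟩

/-- The coinvariants of a finitely generated module stabilize. -/
theorem IsFinitelyGenerated.coinvariantsStabilize {M : C ⥤ ModuleCat.{w} ℂ}
    (hM : IsFinitelyGenerated M) : CoinvariantsStabilize M := by
  classical
  obtain ⟨S, hS⟩ := hM.exists_span_eq_top
  have hspan (d : C) : Submodule.span ℂ {y : Coinv M d | ∃ s ∈ S, ∃ f : s.1 ⟶ d,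
      Representation.Coinvariants.mk (autRep M d) ((M.map f).hom s.2) = y} = ⊤ := by
    have h := congrArg (Submodule.map (Representation.Coinvariants.mk (autRep M d))) (hS d)
    rw [Submodule.map_span, Submodule.map_top, LinearMap.range_eq_top.2
      (Representation.Coinvariants.mk_surjective _)] at h
    rw [← h]
    congr 1
    ext y
    constructor
    · rintro ⟨s, hs, f, rfl⟩
      exact ⟨_, ⟨s, hs, f, rfl⟩, rfl⟩
    · rintro ⟨_, ⟨s, hs, f, rfl⟩, rfl⟩
      exact ⟨s, hs, f, rfl⟩
  refine CoinvariantsStabilize.of_surjective M (fun d => ?_) fun e => ?_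
  · refine Module.finite_def.2 (Submodule.fg_def.2 ⟨_, ?_, hspan d⟩)
    have := IsFIType.finite_hom (C := C)
    have h : {y : Coinv M d | ∃ s ∈ S, ∃ f : s.1 ⟶ d,
        Representation.Coinvariants.mk (autRep M d) ((M.map f).hom s.2) = y} =
        ⋃ s ∈ S, Set.range fun f : s.1 ⟶ d =>
          Representation.Coinvariants.mk (autRep M d) ((M.map f).hom s.2) := by
      ext y
      simp only [Set.mem_ofPred_eq, Set.mem_iUnion, Set.mem_range, exists_prop]
    rw [h]
    exact S.finite_toSet.biUnion fun s _ => Set.finite_range _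
  -- `A c` is the set of generators that reach `c`. It grows along morphisms within `S`, so
  -- minimizing the size of its complement above `e` gives an object beyond which it is constant.
  · let A (c : C) : Finset (Σ c : C, M.obj c) := S.filter fun s => Nonempty (s.1 ⟶ c)
    have hA {c d : C} (f : c ⟶ d) : A c ⊆ A d := fun s hs => by
      simp only [A, Finset.mem_filter] at hs ⊢
      exact ⟨hs.1, hs.2.map (· ≫ f)⟩
    let R : Set C := {c | Nonempty (e ⟶ c)}
    have hR : R.Nonempty := ⟨e, ⟨𝟙 e⟩⟩
    let c := Function.argminOn (fun c => S.card - (A c).card) R hR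
    obtain ⟨k⟩ : Nonempty (e ⟶ c) := Function.argminOn_mem _ R hR
    have hc (d : C) (f : c ⟶ d) : A d = A c := by
      have hle : S.card - (A c).card ≤ S.card - (A d).card :=
        Function.argminOn_le (fun c => S.card - (A c).card) R ⟨k ≫ f⟩
      have h₁ : (A c).card ≤ S.card := Finset.card_filter_le _ _
      have h₂ : (A d).card ≤ S.card := Finset.card_filter_le _ _
      exact (Finset.eq_of_subset_of_card_le (hA f) (by omega)).symm
    refine ⟨c, ⟨k⟩, fun d d' l f => ?_⟩
    rw [← LinearMap.range_eq_top, eq_top_iff, ← hspan d', Submodule.span_le]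
    rintro _ ⟨s, hs, g, rfl⟩
    have hsA : s ∈ A d' := Finset.mem_filter.2 ⟨hs, ⟨g⟩⟩
    -- A generator reaching `d'` already reaches `d`, by some `g'`. Then `g' ≫ f` and `g` are
    -- parallel, hence give the same class.
    rw [hc d' (l ≫ f), ← hc d l] at hsA
    obtain ⟨g'⟩ := (Finset.mem_filter.1 hsA).2
    refine ⟨Representation.Coinvariants.mk (autRep M d) ((M.map g').hom s.2), ?_⟩
    rw [coinvMap_mk, mk_map_eq_mk_map M g (g' ≫ f)]
    simp

end Stabilization
-- Averaging over a finite group.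
section Average

variable {G : Type*} [Group G] [Fintype G] {V W : Type*} [AddCommGroup V] [Module ℂ V]
  [AddCommGroup W] [Module ℂ W] (ρ : Representation ℂ G V) (σ : Representation ℂ G W)

theorem averageHom_toLinearMap (T : V →ₗ[ℂ] W) :
    (averageHom ρ σ T).toLinearMap = (Fintype.card G : ℂ)⁻¹ • ∑ g : G, ρ.linHom σ g T := by
  rw [← LinearMap.sum_apply]
  rfl

/-- An equivariant map is its own average. -/
theorem averageHom_surjective : Function.Surjective (averageHom ρ σ) := by
  intro T
  refine ⟨T.toLinearMap, Representation.IntertwiningMap.toLinearMap_injective ρ σ ?_⟩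
  have hT : ∀ g : G, ρ.linHom σ g T.toLinearMap = T.toLinearMap :=
    ((Representation.invariantsEquivIntertwiningMap ρ σ).symm T).2
  change (averageHom ρ σ T.toLinearMap).toLinearMap = T.toLinearMap
  rw [averageHom_toLinearMap, Finset.sum_congr rfl fun g _ => hT g, Finset.sum_const,
    Finset.card_univ, ← Nat.cast_smul_eq_nsmul ℂ, inv_smul_smul₀]
  exact Nat.cast_ne_zero.2 Fintype.card_ne_zero

/-- The orbit sum of `t` has class `|G|` times that of `t`, and `|G|` is invertible in `ℂ`. -/
theorem coinvariants_mk_eq_zero_of_sum_eq_zero {t : V} (h : ∑ g : G, ρ g t = 0) :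
    Representation.Coinvariants.mk ρ t = 0 := by
  have h' := congrArg (Representation.Coinvariants.mk ρ) h
  simp only [map_sum, Representation.Coinvariants.mk_self_apply, map_zero, Finset.sum_const,
    Finset.card_univ] at h'
  rw [← Nat.cast_smul_eq_nsmul ℂ] at h'
  exact (smul_eq_zero.1 h').resolve_left (Nat.cast_ne_zero.2 Fintype.card_ne_zero)

end Average

/-! ### Perfectness of the pairing and the comparison of coinvariants with equivariant maps. -/

section Pairing

variable {C : Type u} [Category.{v} C]

theorem indObj_mk_single_comp {c d : C} {V : Type w} [AddCommGroup V] [Module ℂ V]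
    (ρ : Representation ℂ (Aut c) V) (ψ : Aut c) (f : c ⟶ d) (x : V) :
    (Submodule.Quotient.mk (Finsupp.single (ψ.hom ≫ f) x) : IndObj ρ d) =
      Submodule.Quotient.mk (Finsupp.single f (ρ ψ x)) :=
  (Submodule.Quotient.eq _).2 (Submodule.subset_span ⟨(ψ, f, x), rfl⟩)

/-- Precomposition with an automorphism permutes the morphisms. -/
def autPrecomp {c : C} (d : C) (ψ : Aut c) : (c ⟶ d) ≃ (c ⟶ d) where
  toFun f := ψ.hom ≫ f
  invFun f := ψ.inv ≫ f
  left_inv f := ψ.inv_hom_id_assoc f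
  right_inv f := ψ.hom_inv_id_assoc f

variable [IsFIType C]

theorem indPairing_mk {c : C} {V : Type w} [AddCommGroup V] [Module ℂ V]
    (ρ : Representation ℂ (Aut c) V) (d : C) (a : (c ⟶ d) →₀ Module.Dual ℂ V)
    (x : (c ⟶ d) →₀ V) :
    indPairing ρ d (Submodule.Quotient.mk a) (Submodule.Quotient.mk x) = rawPairing ρ d a x := rfl

/-- The pairing with `g ⊗ x`, computed coefficientwise. -/
theorem rawPairing_apply_single {c : C} {V : Type w} [AddCommGroup V] [Module ℂ V]
    (ρ : Representation ℂ (Aut c) V) (d : C) (a : (c ⟶ d) →₀ Module.Dual ℂ V) (g : c ⟶ d)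
    (x : V) :
    rawPairing ρ d a (Finsupp.single g x) = ∑ ψ : Aut c, a (ψ.inv ≫ g) (ρ ψ x) := by
  classical
  induction a using Finsupp.induction_linear with
  | zero => simp
  | add a b ha hb => simp [ha, hb, Finset.sum_add_distrib]
  | single f φ =>
    rw [rawPairing_single]
    refine Finset.sum_congr rfl fun ψ _ => ?_
    have h : ψ.hom ≫ f = g ↔ f = ψ.inv ≫ g := (Iso.eq_inv_comp (show c ≅ c from ψ)).symm
    rw [Finsupp.single_apply, h]
    split_ifs <;> simp

/-- The pairing of an induction module with its dual is perfect. -/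
theorem indPairing_bijective {c : C} {V : Type w} [AddCommGroup V] [Module ℂ V]
    (ρ : Representation ℂ (Aut c) V) (d : C) : Function.Bijective (indPairing ρ d) := by
  classical
  have := IsFIType.finite_hom c d
  have := Fintype.ofFinite (c ⟶ d)
  have hcard : (Fintype.card (Aut c) : ℂ) ≠ 0 := Nat.cast_ne_zero.2 Fintype.card_ne_zero
  constructor
  · rw [← LinearMap.ker_eq_bot, LinearMap.ker_eq_bot']
    intro a ha
    obtain ⟨a, rfl⟩ := Submodule.Quotient.mk_surjective _ a
    -- Pairing to zero with every `g ⊗ x` says that the twisted orbit sum of the coefficients of `a`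
    -- vanishes at each `g`.
    have hzero (g : c ⟶ d) : ∑ ψ : Aut c, ρ.dual ψ⁻¹ (a (ψ.inv ≫ g)) = 0 := by
      ext x
      have h := congrArg (fun l => l (Submodule.Quotient.mk (Finsupp.single g x))) ha
      simp only [indPairing_mk, rawPairing_apply_single] at h
      simpa [Module.Dual.transpose_apply] using h
    -- The relation of the tensor product over `G_c` moves `ψ` across each term. Summing these
    -- expressions over `ψ` gives `|G_c|` copies of `a` on one side and the sums of `hzero` on the
    -- other.
    have hψ (ψ : Aut c) : (Submodule.Quotient.mk a : IndObj ρ.dual d) =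
        ∑ g : c ⟶ d, Submodule.Quotient.mk
          (Finsupp.single g (ρ.dual ψ⁻¹ (a (ψ.inv ≫ g)))) := by
      have ha : a = ∑ f : c ⟶ d, Finsupp.single f (a f) := (Finsupp.univ_sum_single a).symm
      conv_lhs => rw [ha]
      rw [← Submodule.mkQ_apply, map_sum]
      refine Fintype.sum_equiv (autPrecomp d ψ) _ _ fun f => ?_
      have h : ψ.inv ≫ autPrecomp d ψ f = f := (autPrecomp d ψ).left_inv f
      rw [h]
      change _ = (Submodule.Quotient.mk (Finsupp.single (ψ.hom ≫ f) _) : IndObj ρ.dual d)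
      rw [indObj_mk_single_comp, ← Module.End.mul_apply, ← map_mul, mul_inv_cancel, map_one]
      rfl
    have hsum : (Fintype.card (Aut c) : ℂ) • (Submodule.Quotient.mk a : IndObj ρ.dual d) = 0 := by
      rw [Nat.cast_smul_eq_nsmul, ← Finset.card_univ, ← Finset.sum_const,
        Finset.sum_congr rfl fun ψ _ => hψ ψ, Finset.sum_comm]
      refine Finset.sum_eq_zero fun g _ => ?_
      have h := congrArg ((indRel ρ.dual d).mkQ ∘ₗ Finsupp.lsingle g) (hzero g)
      rwa [map_sum, map_zero] at h
    exact (smul_eq_zero.1 hsum).resolve_left hcard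
  · intro l
    -- The coefficient at `f` is `|G_c|⁻¹ l(f ⊗ ·)`: pairing with `g ⊗ x` yields `|G_c|` terms, all
    -- equal because `l` is defined on the quotient.
    refine ⟨Submodule.Quotient.mk (Finsupp.equivFunOnFinite.symm fun f =>
      (Fintype.card (Aut c) : ℂ)⁻¹ • (l ∘ₗ (indRel ρ d).mkQ ∘ₗ Finsupp.lsingle f)), ?_⟩
    refine Submodule.linearMap_qext _ (Finsupp.lhom_ext fun g x => ?_)
    change indPairing ρ d _ (Submodule.Quotient.mk _) = l (Submodule.Quotient.mk _)
    rw [indPairing_mk, rawPairing_apply_single]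
    have h (ψ : Aut c) : l (Submodule.Quotient.mk (Finsupp.single (ψ.inv ≫ g) (ρ ψ x))) =
        l (Submodule.Quotient.mk (Finsupp.single g x)) := by
      rw [← indObj_mk_single_comp]
      exact congrArg (fun f => l (Submodule.Quotient.mk (Finsupp.single f x)))
        (ψ.hom_inv_id_assoc g)
    change ∑ ψ : Aut c, (Fintype.card (Aut c) : ℂ)⁻¹ •
      l (Submodule.Quotient.mk (Finsupp.single (ψ.inv ≫ g) (ρ ψ x))) = _
    rw [Finset.sum_congr rfl fun ψ _ => congrArg _ (h ψ), Finset.sum_const, Finset.card_univ,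
      ← Nat.cast_smul_eq_nsmul ℂ, smul_inv_smul₀ hcard]

theorem FreeData.pairing_apply (P : FreeData.{u, v, w} C) (d : C) (a : P.dual.toModule.obj d)
    (x : P.toModule.obj d) :
    P.pairing d a x = ∑ i : Fin P.n, indPairing (P.rep i) d (a i) (x i) := by
  simp only [FreeData.pairing, LinearMap.sum_apply]
  rfl

theorem FreeData.pairing_apply_single (P : FreeData.{u, v, w} C) (d : C)
    (a : P.dual.toModule.obj d) (i : Fin P.n) (x : IndObj (P.rep i) d) :
    P.pairing d a (Pi.single (M := fun i => IndObj (P.rep i) d) i x) =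
      indPairing (P.rep i) d (a i) x := by
  refine (P.pairing_apply d a _).trans ((Finset.sum_eq_single i ?_ ?_).trans ?_)
  · intro j _ hj
    rw [Pi.single_eq_of_ne hj, map_zero]
  · simp
  · rw [Pi.single_eq_same]

/-- The pairing of a free module with its dual is perfect. -/
theorem FreeData.pairing_bijective (P : FreeData.{u, v, w} C) (d : C) :
    Function.Bijective (P.pairing d) := by
  constructor
  · rw [← LinearMap.ker_eq_bot, LinearMap.ker_eq_bot']
    intro a ha
    refine funext fun i : Fin P.n => ?_
    have h : indPairing (P.rep i) d (a i) = 0 := LinearMap.ext fun x =>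
      (P.pairing_apply_single d a i x).symm.trans (by rw [ha]; rfl)
    exact (indPairing_bijective (P.rep i) d).1 (h.trans (map_zero _).symm)
  · intro l
    choose a ha using fun i => (indPairing_bijective (P.rep i) d).2
      (l ∘ₗ LinearMap.single ℂ (fun i => IndObj (P.rep i) d) i)
    refine ⟨a, LinearMap.pi_ext (φ := fun i => IndObj (P.rep i) d) fun i x => ?_⟩
    exact (P.pairing_apply_single d a i x).trans (LinearMap.congr_fun (ha i) x)

theorem FreeData.finite_obj (P : FreeData.{u, v, w} C) (d : C) :
    Module.Finite ℂ (P.toModule.obj d) := by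
  have := fun c : C => IsFIType.finite_hom c d
  change Module.Finite ℂ (∀ i, IndObj (P.rep i) d)
  infer_instance

variable {F : C ⥤ ModuleCat.{max v w} ℂ} (P : FreeData.{u, v, w} C) (e : F ≅ P.toModule)
  (M : C ⥤ ModuleCat.{w₁} ℂ)

/-- The perfect pairing turns `F*_d` into the dual of `F_d`. As `F_d` is finite-dimensional, dual
tensor `M_d` is all of `Hom(F_d, M_d)`, whatever the dimension of `M_d`. -/
theorem contraction_bijective (d : C) : Function.Bijective (contraction P e M d) := by
  have := P.finite_obj d
  let E : F.obj d ≃ₗ[ℂ] P.toModule.obj d := (e.app d).toLinearEquiv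
  have : Module.Finite ℂ (F.obj d) := Module.Finite.equiv E.symm
  have hB : Function.Bijective ((P.pairing d).compl₂ (e.hom.app d).hom) :=
    E.dualMap.bijective.comp (P.pairing_bijective d)
  have hT : Function.Bijective (LinearMap.rTensor (M.obj d)
      ((P.pairing d).compl₂ (e.hom.app d).hom)) :=
    (LinearEquiv.rTensor (M.obj d) (LinearEquiv.ofBijective _ hB)).bijective
  exact (dualTensorHom_bijective ..).comp hT

/-- The canonical map from coinvariants to equivariant homomorphisms is an isomorphism. -/
theorem coinvToHom_bijective (d : C) : Function.Bijective (coinvToHom P e M d) := by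
  constructor
  · rw [← LinearMap.ker_eq_bot, LinearMap.ker_eq_bot']
    intro y hy
    obtain ⟨t, rfl⟩ := Representation.Coinvariants.mk_surjective _ y
    -- Contraction is equivariant and injective, so a vanishing average of the contraction of `t`
    -- forces the orbit sum of `t` to vanish.
    refine coinvariants_mk_eq_zero_of_sum_eq_zero _ ((contraction_bijective P e M d).1 ?_)
    have h : averageHom (autRep F d) (autRep M d) (contraction P e M d t) = 0 := hy
    have h' := congrArg Representation.IntertwiningMap.toLinearMap h
    rw [averageHom_toLinearMap] at h'
    rw [map_sum, map_zero, Finset.sum_congr rfl fun g _ => contraction_autRep P e M d g t]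
    exact (smul_eq_zero.1 h').resolve_left
      (inv_ne_zero (Nat.cast_ne_zero.2 Fintype.card_ne_zero))
  · intro T
    obtain ⟨S, rfl⟩ := averageHom_surjective _ _ T
    obtain ⟨t, rfl⟩ := (contraction_bijective P e M d).2 S
    exact ⟨Representation.Coinvariants.mk _ t, rfl⟩

end Pairing

theorem mainTheorem6 {C : Type u} [Category.{v} C] [IsFIType C]
    (M : C ⥤ ModuleCat.{w₁} ℂ) (hM : IsFinitelyGenerated M) :
    CoinvariantsStabilize M ∧
    (∀ F : C ⥤ ModuleCat.{max v w} ℂ, IsFreeModule.{u, v, w} F →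
      CoinvariantsStabilize (tensorModule F M)) ∧
    (∀ (F : C ⥤ ModuleCat.{max v w} ℂ) (P : FreeData.{u, v, w} C) (e : F ≅ P.toModule),
      (∀ c : C, Function.Bijective (coinvToHom P e M c)) ∧
      ∃ X : Set C, IsUpwardClosed X ∧ IsCofinalSet X ∧
        ∀ c ∈ X, ∀ (d : C) (f : c ⟶ d),
          ∃ Ψ : (autRep F c).IntertwiningMap (autRep M c) ≃ₗ[ℂ]
              (autRep F d).IntertwiningMap (autRep M d),
            ∀ x : Coinv (tensorModule P.dual.toModule M) c,
              Ψ (coinvToHom P e M c x) =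
                coinvToHom P e M d (coinvMap (tensorModule P.dual.toModule M) f x)) := by
  refine ⟨hM.coinvariantsStabilize, ?_, fun F P e => ⟨coinvToHom_bijective P e M, ?_⟩⟩
  · rintro F ⟨P, ⟨e⟩⟩
    exact ((P.isFinitelyGenerated_toModule.of_iso e).tensorModule hM).coinvariantsStabilize
  · obtain ⟨X, hup, hcof, hX⟩ :=
      (P.dual.isFinitelyGenerated_toModule.tensorModule hM).coinvariantsStabilize
    refine ⟨X, hup, hcof, fun c hc d f => ?_⟩
    let α (c : C) := LinearEquiv.ofBijective _ (coinvToHom_bijective P e M c)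
    -- The isomorphism on coinvariants of `F* ⊗ M` is conjugated by `α`.
    refine ⟨(α c).symm ≪≫ₗ LinearEquiv.ofBijective _ (hX c hc d f) ≪≫ₗ α d, fun x => ?_⟩
    have h : (α c).symm (coinvToHom P e M c x) = x := (α c).symm_apply_apply x
    exact congrArg (fun y => α d (LinearEquiv.ofBijective _ (hX c hc d f) y)) h
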